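/- A binary tree is either the empty tree $\emptyset$ or a node with an ordered pair $(L,R)$ of binary trees, its left and right subtrees. A right rotation of a binary tree replaces a subtree $y(x(A,B),C)$ by $x(A,y(B,C))$, where $A,B,C$ are possibly empty binary trees. The Tamari order is the reflexive transitive closure of right rotation: $T'\le T$ if and only if $T$ is obtained from $T'$ by a finite (possibly empty) sequence of right rotations. Let $\ell(T)$ (respectively $r(T)$) be the number of nodes on the leftmost branch (respectively on the right border) of $T$, that is, on the path that starts at the root and goes to the left (respectively right) child as long as there is one; $\ell(\emptyset)=r(\emptyset)=0$. Define polynomials $B_T(x),\tilde B_T(x)\in\mathbb{Z}[x]$ recursively by $B_\emptyset=\tilde B_\emptyset=1$ and, for $T$ with left subtree $L$ and right subtree $R$, $$B_T(x)=x\,B_L(x)\,\frac{x\,B_R(x)-B_R(1)}{x-1},\qquad \tilde B_T(x)=x\,\tilde B_R(x)\,\frac{x\,\tilde B_L(x)-\tilde B_L(1)}{x-1}.$$ Theorem. Let $T$ be a binary tree. The set of binary trees $T'\le T$ is finite and $$B_T(x)=\sum_{T'\le T}x^{\ell(T')}.$$ That is, for every $k\ge 0$ the coefficient of $x^k$ in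 $B_T(x)$ is the number of trees $T'\le T$ with exactly $k$ nodes on their leftmost branch. In particular, $B_T(1)$ is the number of trees $T'\le T$. Symmetrically, the set of binary trees $T'\ge T$ is finite and $$\tilde B_T(x)=\sum_{T'\ge T}x^{r(T')},$$ that is, for every $k\ge 0$ the coefficient of $x^k$ in $\tilde B_T(x)$ is the number of trees $T'\ge T$ with exactly $k$ nodes on their right border. In particular, $\tilde B_T(1)$ is the number of trees $T'\ge T$. -/

import Mathlib

open Polynomial

namespace TamariTree

/-- `Rotation S T`: the planar binary tree `T` is obtained from `S` by one right rotation, that is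
by replacing a subtree `y(x(A, B), C)` of `S` by `x(A, y(B, C))`, where `A`, `B`, `C` may be
empty. -/
inductive Rotation : BinaryTree Unit → BinaryTree Unit → Prop
  | root (A B C : BinaryTree Unit) :
      Rotation (.node () (.node () A B) C) (.node () A (.node () B C))
  | left {L L' : BinaryTree Unit} (R : BinaryTree Unit) (h : Rotation L L') :
      Rotation (.node () L R) (.node () L' R)
  | right (L : BinaryTree Unit) {R R' : BinaryTree Unit} (h : Rotation R R') :
      Rotation (.node () L R) (.node () L R')

/-- The Tamari order: `TamariLE S T` (read `S ≤ T`) if `T` is obtained from `S` by a finite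
(possibly empty) sequence of right rotations. -/
def TamariLE (S T : BinaryTree Unit) : Prop := Relation.ReflTransGen Rotation S T

/-- The number of nodes on the leftmost branch (the path that starts at the root and goes to the
left child as long as there is one). -/
def leftBranch : BinaryTree Unit → ℕ
  | .nil => 0
  | .node _ L _ => leftBranch L + 1

/-- The number of nodes on the right border (the path that starts at the root and goes to the
right child as long as there is one). -/
def rightBranch : BinaryTree Unit → ℕ
  | .nil => 0
  | .node _ _ R => rightBranch R + 1

/-- The Tamari polynomial: `B_∅ = 1` and `B_T(x) = x B_L(x) (x B_R(x) - B_R(1)) / (x - 1)` where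
`L`, `R` are the left and right subtrees of `T`. The quotient is the one of Euclidean division by
the monic polynomial `X - 1`; it is exact, see `sub_one_mul_tamariPoly_node`. -/
noncomputable def tamariPoly : BinaryTree Unit → ℤ[X]
  | .nil => 1
  | .node _ L R => X * tamariPoly L *
      ((X * tamariPoly R - C ((tamariPoly R).eval 1)) /ₘ (X - C 1))

/-- The Tamari polynomial with the roles of left and right subtrees exchanged. -/
noncomputable def tamariPolySwap : BinaryTree Unit → ℤ[X]
  | .nil => 1
  | .node _ L R => X * tamariPolySwap R *
      ((X * tamariPolySwap L - C ((tamariPolySwap L).eval 1)) /ₘ (X - C 1))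

theorem sub_one_mul_divByMonic (p : ℤ[X]) :
    (X - C 1) * ((X * p - C (p.eval 1)) /ₘ (X - C 1)) = X * p - C (p.eval 1) := by
  rw [mul_divByMonic_eq_iff_isRoot]
  simp

theorem sub_one_mul_tamariPoly_node (L R : BinaryTree Unit) :
    (X - C 1) * tamariPoly (.node () L R) =
      X * tamariPoly L * (X * tamariPoly R - C ((tamariPoly R).eval 1)) := by
  rw [← sub_one_mul_divByMonic, tamariPoly]
  ring

theorem sub_one_mul_tamariPolySwap_node (L R : BinaryTree Unit) :
    (X - C 1) * tamariPolySwap (.node () L R) =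
      X * tamariPolySwap R * (X * tamariPolySwap L - C ((tamariPolySwap L).eval 1)) := by
  rw [← sub_one_mul_divByMonic, tamariPolySwap]
  ring

end TamariTree

namespace TamariTree

/-! ### Rotations and the Tamari order -/

/-! The trees below `node L R` are exactly those obtained from some `L' ≤ L` and `R' ≤ R` by
inserting a new node with left subtree `L'` on the leftmost branch of `R'` (`tamariLE_node_iff`).
The pair `(L', R')` is unique, since rotations preserve size (`eq_of_mem_insertions`). Inserting
below `i` nodes of the branch, `0 ≤ i ≤ ℓ(R')`, gives a leftmost branch of `ℓ(L') + 1 + i` nodes.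
The geometric sum over `i`, summed over all pairs, is the recursion for `B`. Reflection reverses the
order and gives the dual half. -/

theorem Rotation.numNodes_eq {S T : BinaryTree Unit} (h : Rotation S T) :
    S.numNodes = T.numNodes := by
  induction h <;> simp only [BinaryTree.numNodes] <;> omega

theorem TamariLE.numNodes_eq {S T : BinaryTree Unit} (h : TamariLE S T) :
    S.numNodes = T.numNodes := by
  induction h with
  | refl => rfl
  | tail _ h ih => exact ih.trans h.numNodes_eq

theorem TamariLE.node {L L' R R' : BinaryTree Unit} (hL : TamariLE L L') (hR : TamariLE R R') :
    TamariLE (.node () L R) (.node () L' R') :=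
  (Relation.ReflTransGen.lift (fun A ↦ BinaryTree.node () A R)
    (fun _ _ h ↦ Rotation.left R h) _ _ hL).trans
  (Relation.ReflTransGen.lift (fun A ↦ BinaryTree.node () L' A)
    (fun _ _ h ↦ Rotation.right L' h) _ _ hR)

theorem tamariLE_nil_iff {S : BinaryTree Unit} : TamariLE S .nil ↔ S = .nil := by
  refine ⟨fun h ↦ ?_, fun h ↦ h ▸ .refl⟩
  cases S with
  | nil => rfl
  | node _ _ _ => simpa using h.numNodes_eq

/-! ### Inserting a tree on the leftmost branch -/

/-- The trees obtained from `R` by replacing a subtree `A` that hangs on its leftmost branch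
(possibly `R` itself, or the empty tree at the end of the branch) by a new node with left subtree
`L` and right subtree `A`. -/
def insertions (L : BinaryTree Unit) : BinaryTree Unit → Finset (BinaryTree Unit)
  | .nil => {.node () L .nil}
  | .node _ R₁ R₂ => insert (.node () L (.node () R₁ R₂))
      ((insertions L R₁).image fun P ↦ .node () P R₂)

theorem node_mem_insertions (L R : BinaryTree Unit) : .node () L R ∈ insertions L R := by
  cases R <;> simp [insertions]

theorem node_mem_insertions_node {L R P : BinaryTree Unit} (h : P ∈ insertions L R)
    (A : BinaryTree Unit) : .node () P A ∈ insertions L (.node () R A) :=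
  Finset.mem_insert_of_mem (Finset.mem_image_of_mem _ h)

@[elab_as_elim]
theorem insertions_induction {L : BinaryTree Unit}
    {motive : ∀ R P : BinaryTree Unit, P ∈ insertions L R → Prop}
    (root : ∀ R, motive R (.node () L R) (node_mem_insertions L R))
    (step : ∀ R P A (h : P ∈ insertions L R), motive R P h →
      motive (.node () R A) (.node () P A) (node_mem_insertions_node h A))
    {R P : BinaryTree Unit} (h : P ∈ insertions L R) : motive R P h := by
  induction R generalizing P with
  | nil =>
    obtain rfl := Finset.mem_singleton.1 h
    exact root _
  | node _ R₁ R₂ ih _ =>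
    have h' := h
    simp only [insertions, Finset.mem_insert, Finset.mem_image] at h'
    obtain rfl | ⟨P, hP, rfl⟩ := h'
    · exact root _
    · exact step _ _ _ hP (ih hP)

theorem numNodes_of_mem_insertions {L R P : BinaryTree Unit} (h : P ∈ insertions L R) :
    P.numNodes = L.numNodes + R.numNodes + 1 := by
  induction h using insertions_induction with
  | root R => rfl
  | step R P A h ih => simp only [BinaryTree.numNodes, ih]; omega

/-- A rotation at the parent of the inserted node lifts it one place; repeating this brings it to
the root. -/
theorem tamariLE_of_mem_insertions {L R P : BinaryTree Unit} (h : P ∈ insertions L R) :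
    TamariLE P (.node () L R) := by
  induction h using insertions_induction with
  | root R => exact .refl
  | step R P A h ih => exact (ih.node .refl).tail (.root L R A)

/-- A tree with a rotation to a member of `insertions L R` is itself in `insertions L' R'` for
some `L'` and `R'` below `L` and `R`. -/
theorem Rotation.exists_mem_insertions {L R S P : BinaryTree Unit} (hSP : Rotation S P)
    (hP : P ∈ insertions L R) :
    ∃ L' R', TamariLE L' L ∧ TamariLE R' R ∧ S ∈ insertions L' R' := by
  induction hP using insertions_induction generalizing S with
  | root R =>
    cases hSP with
    -- Undoing a rotation at the inserted node moves it one place down the branch of `node B C`.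
    | root _ B C =>
      exact ⟨L, _, .refl, .refl, node_mem_insertions_node (node_mem_insertions L B) C⟩
    | left _ h => exact ⟨_, R, .single h, .refl, node_mem_insertions _ _⟩
    | right _ h => exact ⟨L, _, .refl, .single h, node_mem_insertions _ _⟩
  | step R P A hP ih =>
    cases hSP with
    -- Here the rotation lies above the inserted node, so it is a rotation of the host tree.
    | root _ B C =>
      exact ⟨L, _, .refl, .single (.root R B C),
        node_mem_insertions_node (node_mem_insertions_node hP B) C⟩
    | left _ h =>
      obtain ⟨L', R', hL, hR, hS⟩ := ih h
      exact ⟨L', _, hL, hR.node .refl, node_mem_insertions_node hS A⟩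
    | right _ h =>
      exact ⟨L, _, .refl, TamariLE.node .refl (.single h), node_mem_insertions_node hP _⟩

theorem tamariLE_node_iff {S L R : BinaryTree Unit} :
    TamariLE S (.node () L R) ↔
      ∃ L' R', TamariLE L' L ∧ TamariLE R' R ∧ S ∈ insertions L' R' := by
  constructor
  · intro h
    induction h using Relation.ReflTransGen.head_induction_on with
    | refl => exact ⟨L, R, .refl, .refl, node_mem_insertions L R⟩
    | head h _ ih =>
      obtain ⟨L₁, R₁, hL₁, hR₁, hP⟩ := ih
      obtain ⟨L₂, R₂, hL₂, hR₂, hS⟩ := h.exists_mem_insertions hP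
      exact ⟨L₂, R₂, hL₂.trans hL₁, hR₂.trans hR₁, hS⟩
  · rintro ⟨L', R', hL, hR, hS⟩
    exact (tamariLE_of_mem_insertions hS).trans (hL.node hR)

/-- An insertion determines the inserted tree, if its size is known, and the tree in which it was
inserted. -/
theorem eq_of_mem_insertions {L L' R R' P : BinaryTree Unit} (hn : L.numNodes = L'.numNodes)
    (h : P ∈ insertions L R) (h' : P ∈ insertions L' R') : L = L' ∧ R = R' := by
  -- Left subtrees shrink strictly down the leftmost branch, so the size of `L` locates the inserted
  -- node.
  induction h using insertions_induction generalizing R' with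
  | root R =>
    cases R' with
    | nil => simpa [insertions] using h'
    | node _ R₁ R₂ =>
      simp only [insertions, Finset.mem_insert, Finset.mem_image, BinaryTree.node.injEq,
        true_and] at h'
      obtain h' | ⟨P, hP, rfl, -⟩ := h'
      · exact h'
      · have := numNodes_of_mem_insertions hP
        omega
  | step R P A h ih =>
    have hP := numNodes_of_mem_insertions h
    cases R' with
    | nil =>
      simp only [insertions, Finset.mem_singleton, BinaryTree.node.injEq, true_and] at h'
      obtain ⟨rfl, -⟩ := h'
      omega
    | node _ R₁ R₂ =>
      simp only [insertions, Finset.mem_insert, Finset.mem_image, BinaryTree.node.injEq,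
        true_and] at h'
      obtain ⟨rfl, -⟩ | ⟨Q, hQ, rfl, rfl⟩ := h'
      · omega
      · obtain ⟨rfl, rfl⟩ := ih hQ
        exact ⟨rfl, rfl⟩

/-- The geometric sum over insertion positions, with the denominator cleared. -/
theorem sub_one_mul_sum_insertions (L R : BinaryTree Unit) :
    (X - C 1 : ℤ[X]) * ∑ P ∈ insertions L R, X ^ leftBranch P =
      X * X ^ leftBranch L * (X * X ^ leftBranch R - 1) := by
  induction R with
  | nil => simp [insertions, leftBranch]; ring
  | node _ R₁ R₂ ih _ =>
    -- Equality would force `R₂ = node R₁ R₂`, which sizes exclude.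
    have hroot : (.node () L (.node () R₁ R₂) : BinaryTree Unit) ∉
        (insertions L R₁).image fun P ↦ .node () P R₂ := by
      intro h
      obtain ⟨P, -, hP⟩ := Finset.mem_image.1 h
      have := congrArg BinaryTree.numNodes (BinaryTree.node.inj hP).2.2
      simp only [BinaryTree.numNodes] at this
      omega
    have hinj : Function.Injective fun P : BinaryTree Unit ↦ BinaryTree.node () P R₂ :=
      fun P Q h ↦ (BinaryTree.node.inj h).2.1
    rw [insertions, Finset.sum_insert hroot, Finset.sum_image hinj.injOn, mul_add]
    simp only [leftBranch, pow_succ, ← Finset.sum_mul]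
    rw [← mul_assoc (X - C 1 : ℤ[X]) (∑ P ∈ insertions L R₁, X ^ leftBranch P), ih, C_1]
    ring

/-! ### The trees below a given tree -/

/-- The finite set of binary trees below a given one in the Tamari order. -/
def lowerTrees : BinaryTree Unit → Finset (BinaryTree Unit)
  | .nil => {.nil}
  | .node _ L R => (lowerTrees L ×ˢ lowerTrees R).biUnion fun p ↦ insertions p.1 p.2

theorem mem_lowerTrees {S T : BinaryTree Unit} : S ∈ lowerTrees T ↔ TamariLE S T := by
  induction T generalizing S with
  | nil => simp [lowerTrees, tamariLE_nil_iff]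
  | node _ L R ihL ihR =>
    rw [tamariLE_node_iff]
    simp [lowerTrees, ihL, ihR]

/-- The term `-1` of each geometric sum does not depend on `R'`, so summing it over `R'` produces
`B_R(1)`. -/
theorem tamariPoly_eq_sum (T : BinaryTree Unit) :
    tamariPoly T = ∑ S ∈ lowerTrees T, X ^ leftBranch S := by
  induction T with
  | nil => simp [tamariPoly, lowerTrees, leftBranch]
  | node _ L R ihL ihR =>
    have hdisj : Set.PairwiseDisjoint (↑(lowerTrees L ×ˢ lowerTrees R))
        fun p : BinaryTree Unit × BinaryTree Unit ↦ insertions p.1 p.2 := by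
      intro p hp q hq hpq
      refine Finset.disjoint_left.2 fun P hP hP' ↦ hpq ?_
      simp only [Finset.mem_coe, Finset.mem_product, mem_lowerTrees] at hp hq
      exact Prod.ext_iff.2
        (eq_of_mem_insertions (hp.1.numNodes_eq.trans hq.1.numNodes_eq.symm) hP hP')
    apply mul_left_cancel₀ (X_sub_C_ne_zero (1 : ℤ))
    rw [sub_one_mul_tamariPoly_node, lowerTrees, Finset.sum_biUnion hdisj, Finset.mul_sum]
    simp only [sub_one_mul_sum_insertions]
    rw [Finset.sum_product, ihL, ihR]
    simp only [eval_finsetSum, eval_pow, eval_X, one_pow, map_sum, C_1, Finset.mul_sum,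
      ← Finset.sum_sub_distrib, Finset.sum_mul]
    rw [Finset.sum_comm]

theorem setOf_tamariLE_eq (T : BinaryTree Unit) : {S | TamariLE S T} = ↑(lowerTrees T) := by
  ext S
  simp [mem_lowerTrees]

theorem finite_setOf_tamariLE (T : BinaryTree Unit) : {S | TamariLE S T}.Finite := by
  rw [setOf_tamariLE_eq]
  exact Finset.finite_toSet _

theorem coeff_tamariPoly (T : BinaryTree Unit) (k : ℕ) :
    (tamariPoly T).coeff k = ({S | TamariLE S T ∧ leftBranch S = k}.ncard : ℤ) := by
  have h : {S | TamariLE S T ∧ leftBranch S = k} =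
      ↑((lowerTrees T).filter fun S ↦ k = leftBranch S) := by
    ext S
    simp [mem_lowerTrees, eq_comm]
  rw [h, Set.ncard_coe_finset, tamariPoly_eq_sum, finsetSum_coeff, Finset.card_filter]
  simp [coeff_X_pow]

theorem eval_one_tamariPoly (T : BinaryTree Unit) :
    (tamariPoly T).eval 1 = ({S | TamariLE S T}.ncard : ℤ) := by
  rw [setOf_tamariLE_eq, Set.ncard_coe_finset, tamariPoly_eq_sum]
  simp [eval_finsetSum]

/-! ### Mirror symmetry -/

/-- The mirror image of a binary tree. -/
def mirror : BinaryTree Unit → BinaryTree Unit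
  | .nil => .nil
  | .node _ L R => .node () (mirror R) (mirror L)

theorem mirror_involutive : Function.Involutive mirror := by
  intro T
  induction T with
  | nil => rfl
  | node _ L R ihL ihR => simp [mirror, ihL, ihR]

theorem leftBranch_mirror (T : BinaryTree Unit) : leftBranch (mirror T) = rightBranch T := by
  induction T with
  | nil => rfl
  | node _ L R _ ihR => simp [mirror, leftBranch, rightBranch, ihR]

theorem tamariPoly_mirror (T : BinaryTree Unit) : tamariPoly (mirror T) = tamariPolySwap T := by
  induction T with
  | nil => rfl
  | node _ L R ihL ihR => rw [mirror, tamariPoly, tamariPolySwap, ihL, ihR]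

/-- The two sides of the rotation pattern are exchanged by reflection, up to renaming the subtrees.
-/
theorem Rotation.mirror {S T : BinaryTree Unit} (h : Rotation S T) :
    Rotation (mirror T) (mirror S) := by
  induction h with
  | root A B C => exact .root _ _ _
  | left R _ ih => exact .right _ ih
  | right L _ ih => exact .left _ ih

theorem TamariLE.mirror {S T : BinaryTree Unit} (h : TamariLE S T) :
    TamariLE (mirror T) (mirror S) := by
  induction h with
  | refl => exact .refl
  | tail _ h ih => exact .head h.mirror ih

theorem tamariLE_mirror_iff {S T : BinaryTree Unit} :
    TamariLE (mirror S) (mirror T) ↔ TamariLE T S := by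
  refine ⟨fun h ↦ ?_, TamariLE.mirror⟩
  simpa only [mirror_involutive _] using h.mirror

theorem ncard_setOf_mirror (p : BinaryTree Unit → Prop) :
    {S | p (mirror S)}.ncard = {S | p S}.ncard :=
  Set.ncard_preimage_of_injective_subset_range (s := {S | p S}) mirror_involutive.injective
    (by simp [mirror_involutive.surjective.range_eq])

end TamariTree

theorem mainTheorem1 (T : BinaryTree Unit) :
    ({S : BinaryTree Unit | TamariTree.TamariLE S T}.Finite ∧
      (∀ k : ℕ, (TamariTree.tamariPoly T).coeff k =
        (({S : BinaryTree Unit |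
            TamariTree.TamariLE S T ∧ TamariTree.leftBranch S = k}.ncard : ℕ) : ℤ)) ∧
      (TamariTree.tamariPoly T).eval 1 =
        (({S : BinaryTree Unit | TamariTree.TamariLE S T}.ncard : ℕ) : ℤ)) ∧
    ({S : BinaryTree Unit | TamariTree.TamariLE T S}.Finite ∧
      (∀ k : ℕ, (TamariTree.tamariPolySwap T).coeff k =
        (({S : BinaryTree Unit |
            TamariTree.TamariLE T S ∧ TamariTree.rightBranch S = k}.ncard : ℕ) : ℤ)) ∧
      (TamariTree.tamariPolySwap T).eval 1 =
        (({S : BinaryTree Unit | TamariTree.TamariLE T S}.ncard : ℕ) : ℤ)) := by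

  refine ⟨⟨TamariTree.finite_setOf_tamariLE T, TamariTree.coeff_tamariPoly T,
    TamariTree.eval_one_tamariPoly T⟩, ?_, fun k ↦ ?_, ?_⟩
  · simp only [← TamariTree.tamariLE_mirror_iff (T := T)]
    exact (TamariTree.finite_setOf_tamariLE (TamariTree.mirror T)).preimage
      TamariTree.mirror_involutive.injective.injOn
  · simp only [← TamariTree.tamariLE_mirror_iff (T := T), ← TamariTree.leftBranch_mirror]
    rw [TamariTree.ncard_setOf_mirror fun S ↦
      TamariTree.TamariLE S (TamariTree.mirror T) ∧ TamariTree.leftBranch S = k,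
      ← TamariTree.tamariPoly_mirror, TamariTree.coeff_tamariPoly]
  · simp only [← TamariTree.tamariLE_mirror_iff (T := T)]
    rw [TamariTree.ncard_setOf_mirror fun S ↦ TamariTree.TamariLE S (TamariTree.mirror T),
      ← TamariTree.tamariPoly_mirror, TamariTree.eval_one_tamariPoly]
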